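/- The balanced community modulated random recursive tree BCMRT$(q)$, $q\in[0,1/2]$, is the following random growing tree. At time $1$ it is a single edge joining a node of type $A$ and a node of type $B$, both with time-label $1$. At each time $k\ge 2$ two new nodes with time-label $k$ are added, one of type $A$ and one of type $B$; independently of each other and of the past, each of them decides to connect to a node of its own type with probability $1-q$ or of the other type with probability $q$, and then attaches to a uniformly chosen node among the $k-1$ nodes of the chosen type that have time-label at most $k-1$. After $n$ steps the tree has $2n$ nodes. The tree with its time-labels, but without the types, is observed. For $2\le k\le n$ let $X_k$ be the indicator that the two nodes with time-label $k$ attach to the same node, let $Z_n=\sum_{k=2}^n X_k$, and for $n\ge 2$ put $$\hat q_n=\varphi\!\left(\frac{Z_n}{2\log n}\right),\qquad \varphi(x)=\tfrac12\left(1-\sqrt{(1-4x)_+}\right),\qquad (u)_+=\max(u,0).$$ **Theorem.** Let $0\le q\le 1/2$ and let the tree be a BCMRT$(q)$. Then $\hat q_n\to q$ in probability as $n\to\infty$. Moreover, with $N$ a standard Gaussian random variable and with $\xrightarrow{d}$ denoting convergence in distribution as $n\to\infty$: 1. if $q=0$, then the law of $\hat q_n$ is the Dirac mass at $0$ for every $n\ge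 2$; 2. if $0<q<1/2$, then the speed of convergence of $\hat q_n$ to $q$ is $\sqrt{\log n}$, in the sense that $$\sqrt{\frac{2\log n}{q(1-q)}}\,\bigl(\hat q_n-q\bigr)\ \xrightarrow{d}\ \frac{1}{1-2q}\,N;$$ 3. if $q=1/2$, then the speed of convergence of $\hat q_n$ to $q$ is $(\log n)^{1/4}$, in the sense that $$\left(\frac{\log n}{2}\right)^{1/4}\Bigl(\hat q_n-\tfrac12\Bigr)\ \xrightarrow{d}\ -\tfrac12\sqrt{N_+}.$$ -/

import Mathlib

open MeasureTheory ProbabilityTheory Filter Topology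

noncomputable section

namespace BCMRT

/-- The two community types: `true` is type `A`, `false` is type `B`. -/
abbrev NodeType : Type := Bool

/-- The nodes of a tree with `n` time steps: `(i, s)` is the node of type `s` that
arrived at time `i + 1` (so the times are `1, …, n`, and there are `2 n` nodes). -/
abbrev Node (n : ℕ) : Type := Fin n × NodeType

/-- The time-label (time of arrival) of a node. -/
def timeLabel {n : ℕ} (v : Node n) : ℕ := v.1.val + 1

/-- The nodes already present after `n` steps, seen among the nodes present after `n + 1` steps. -/
def oldNode (n : ℕ) : Node n ↪ Node (n + 1) :=
  Fin.castSuccEmb.prodMap (Function.Embedding.refl NodeType)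

/-- The tree obtained from `G` by adding the two nodes with time-label `n + 1`, the one of type `A`
being joined to `a` and the one of type `B` being joined to `b`. -/
def grow {n : ℕ} (G : SimpleGraph (Node n)) (a b : Node n) : SimpleGraph (Node (n + 1)) :=
  G.map (oldNode n) ⊔ SimpleGraph.edge (Fin.last n, true) (oldNode n a)
    ⊔ SimpleGraph.edge (Fin.last n, false) (oldNode n b)

/-- The law of the decision of a new node: `true` (connect to the other type) with
probability `q`, `false` (connect to its own type) with probability `1 - q`. -/
def switchLaw (q : unitInterval) : PMF Bool :=
  PMF.ofFintype (fun b => if b then ENNReal.ofReal q else ENNReal.ofReal (1 - q)) (by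
    simp [← ENNReal.ofReal_add q.2.1 (sub_nonneg.2 q.2.2)])

/-- The law of the parent of a new node of type `s`, given that there are `n` nodes of each type:
the new node first decides the type of its parent, then chooses it uniformly among
the `n` existing nodes of that type. -/
def parentLaw (q : unitInterval) (n : ℕ) [NeZero n] (s : NodeType) : PMF (Node n) :=
  (switchLaw q).bind fun switch =>
    (PMF.uniformOfFintype (Fin n)).map fun i => (i, if switch then !s else s)

/-- One step of the growth: the two new nodes choose their parents independently. -/
def stepLaw (q : unitInterval) (n : ℕ) [NeZero n] (G : SimpleGraph (Node n)) :
    PMF (SimpleGraph (Node (n + 1))) :=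
  (parentLaw q n true).bind fun a => (parentLaw q n false).map fun b => grow G a b

/-- The law of the balanced community modulated random recursive tree with parameter `q`
after `n` steps (a tree with `2 n` nodes). At time `1` it is a single edge between the two nodes
with time-label `1`. (At time `0` there is no node.) -/
def law (q : unitInterval) : (n : ℕ) → PMF (SimpleGraph (Node n))
  | 0 => PMF.pure ⊥
  | 1 => PMF.pure ⊤
  | n + 2 => (law q (n + 1)).bind (stepLaw q (n + 1))

/-- Random trees on `Node n` are taken with the discrete σ-algebra. -/
instance (n : ℕ) : MeasurableSpace (SimpleGraph (Node n)) := ⊤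

open Classical in
/-- For a graph `G` whose nodes carry time-labels (`label v` is the label of `v`), the statistic
`Z_n`: the number of times `k ∈ {2, …, n}` at which the nodes with label `k` attach to one and the
same earlier node. It depends only on the time-labelled graph, not on the types. -/
def Z {V : Type*} (label : V → ℕ) (G : SimpleGraph V) (n : ℕ) : ℕ :=
  ((Finset.Icc 2 n).filter fun k =>
    ∃ w, label w < k ∧ ∀ v, label v = k → G.Adj v w).card

/-- `φ(x) = (1 - √((1 - 4 x)₊)) / 2`. -/
def phi (x : ℝ) : ℝ := (1 - Real.sqrt (max (1 - 4 * x) 0)) / 2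

/-- The estimator `φ(Z_n / (2 log n))` of `q`, as a function of a time-labelled tree with
labels `1, …, n`. -/
def qHat {V : Type*} (label : V → ℕ) (G : SimpleGraph V) (n : ℕ) : ℝ :=
  phi ((Z label G n : ℝ) / (2 * Real.log n))

end BCMRT

end

/-!
When `n` nodes of each type are present, the two new nodes pick the same parent with probability
`2 q (1 - q) / n`, whatever the past (`integral_parentLaw_coincide`). Since `Z` gains one exactly
in that case (`Z_grow`), it is distributed as a sum of independent Bernoulli variables with
parameters `2 q (1 - q) / m` (`integral_pow_Z`).

The sum of the parameters is `v log n + O(1)` with `v = 2 q (1 - q)`, and the sum of their squares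
is bounded, so the characteristic function of `Z` is close to that of a Poisson variable with mean
`v log n` (`norm_prod_bernoulli_sub_exp_le`). Lévy's continuity theorem then gives the asymptotic
normality of `(Z - v log n) / √(v log n)` (`tendstoInDistribution_standardized_Z`).

For `n ≥ 2` the estimator is `phi (q (1 - q) + w d)`, where `w` is the standardized statistic and
`d` is a deterministic scale tending to zero (`qHat_eq`), and `phi (q (1 - q)) = q` as `q ≤ 1 / 2`.
By Slutsky's theorem for continuous functions of the pair `(w, d)`, the estimator tends to `q` in
distribution, hence in probability. For `q < 1 / 2` the function `phi` is differentiable at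
`q (1 - q)` with derivative `1 / (1 - 2 q)`, and the difference quotient is a continuous function of
`(w, d)`: this is the delta method. For `q = 1 / 2` the point `q (1 - q) = 1 / 4` is the
singularity of the square root, and the rescaled error is an explicit continuous function of `w`. For `q = 0` no coincidence ever happens.
-/

namespace BCMRT

/-! ### The statistic along the growth of the tree -/

section Growth

variable {n : ℕ}

lemma timeLabel_oldNode (v : Node n) : timeLabel (oldNode n v) = timeLabel v := rfl

lemma timeLabel_le (v : Node n) : timeLabel v ≤ n := v.1.isLt

lemma mem_range_oldNode_iff {v : Node (n + 1)} :
    v ∈ Set.range (oldNode n) ↔ timeLabel v ≤ n := by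
  constructor
  · rintro ⟨w, rfl⟩
    exact timeLabel_le w
  · intro h
    exact ⟨(⟨v.1.1, h⟩, v.2), rfl⟩

lemma new_ne_oldNode (s : NodeType) (v : Node n) : (Fin.last n, s) ≠ oldNode n v := by
  intro h
  have h1 := congrArg timeLabel h
  have h2 := timeLabel_le v
  rw [timeLabel_oldNode] at h1
  simp only [timeLabel, Fin.val_last] at h1 h2
  omega

lemma grow_adj_old (G : SimpleGraph (Node n)) (a b v w : Node n) :
    (grow G a b).Adj (oldNode n v) (oldNode n w) ↔ G.Adj v w := by
  have h1 := new_ne_oldNode true v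
  have h2 := new_ne_oldNode true w
  have h3 := new_ne_oldNode false v
  have h4 := new_ne_oldNode false w
  simp only [grow, SimpleGraph.sup_adj, SimpleGraph.map_adj_apply, SimpleGraph.edge_adj]
  grind

lemma grow_adj_new (G : SimpleGraph (Node n)) (a b w : Node n) (s : NodeType) :
    (grow G a b).Adj (Fin.last n, s) (oldNode n w) ↔ w = if s then a else b := by
  have h1 := new_ne_oldNode true w
  have h2 := new_ne_oldNode false w
  have h3 : ¬ (G.map (oldNode n)).Adj (Fin.last n, s) (oldNode n w) := by
    rintro ⟨-, x, y, -, h, -⟩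
    exact new_ne_oldNode s x h.symm
  have h4 := (oldNode n).injective
  simp only [grow, SimpleGraph.sup_adj, h3, SimpleGraph.edge_adj]
  cases s <;> simp <;> grind [Function.Injective]

/-- A coincidence at an earlier time is neither created nor destroyed by the growth. -/
lemma exists_common_parent_grow_old (G : SimpleGraph (Node n)) (a b : Node n) {k : ℕ}
    (hk : k ≤ n) :
    (∃ w, timeLabel w < k ∧ ∀ v, timeLabel v = k → (grow G a b).Adj v w) ↔
      ∃ w, timeLabel w < k ∧ ∀ v, timeLabel v = k → G.Adj v w := by
  constructor
  · rintro ⟨w, hw, h⟩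
    obtain ⟨w, rfl⟩ := mem_range_oldNode_iff.2 (hw.le.trans hk)
    exact ⟨w, hw, fun v hv => (grow_adj_old G a b v w).1 (h _ hv)⟩
  · rintro ⟨w, hw, h⟩
    refine ⟨oldNode n w, hw, fun v hv => ?_⟩
    obtain ⟨v, rfl⟩ := mem_range_oldNode_iff.2 (hv.le.trans hk)
    exact (grow_adj_old G a b v w).2 (h v hv)

/-- The only neighbour of a newest node is its parent, so a common one means equal parents. -/
lemma exists_common_parent_grow_new (G : SimpleGraph (Node n)) (a b : Node n) :
    (∃ w, timeLabel w < n + 1 ∧ ∀ v, timeLabel v = n + 1 → (grow G a b).Adj v w) ↔ a = b := by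
  constructor
  · rintro ⟨w, hw, h⟩
    obtain ⟨w, rfl⟩ := mem_range_oldNode_iff.2 (Nat.lt_succ_iff.1 hw)
    have h1 := (grow_adj_new G a b w true).1 (h _ rfl)
    have h2 := (grow_adj_new G a b w false).1 (h _ rfl)
    simp only [if_true, Bool.false_eq_true, if_false] at h1 h2
    exact h1.symm.trans h2
  · rintro rfl
    refine ⟨oldNode n a, Nat.lt_succ_of_le (timeLabel_le a), fun v hv => ?_⟩
    obtain ⟨i, s⟩ := v
    obtain rfl : i = Fin.last n := Fin.ext (Nat.succ_injective hv)
    exact (grow_adj_new G a a a s).2 (by simp)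

open Classical in
/-- The statistic gains one at a step exactly when the two new nodes choose the same parent. -/
lemma Z_grow (hn : 1 ≤ n) (G : SimpleGraph (Node n)) (a b : Node n) :
    Z timeLabel (grow G a b) (n + 1) = Z timeLabel G n + if a = b then 1 else 0 := by
  unfold Z
  rw [← Finset.insert_Icc_right_eq_Icc_add_one (by omega), Finset.filter_insert]
  simp only [exists_common_parent_grow_new]
  have hold k (hk : k ∈ Finset.Icc 2 n) :=
    exists_common_parent_grow_old G a b (Finset.mem_Icc.1 hk).2
  split_ifs
  · rw [Finset.card_insert_of_notMem (by simp)]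
    refine congrArg (Finset.card · + 1) (Finset.ext fun k => ?_)
    simpa only [Finset.mem_filter] using and_congr_right (hold k)
  · rw [add_zero]
    refine congrArg Finset.card (Finset.ext fun k => ?_)
    simpa only [Finset.mem_filter] using and_congr_right (hold k)

lemma Z_one {V : Type*} (label : V → ℕ) (G : SimpleGraph V) : Z label G 1 = 0 := by
  simp [Z]

end Growth

/-! ### The generating function of the statistic -/

section Integrals

lemma integral_bind {α β : Type*} [Finite α] [Finite β] [MeasurableSpace α] [MeasurableSpace β]
    [MeasurableSingletonClass α] [MeasurableSingletonClass β] (p : PMF α) (k : α → PMF β)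
    (f : β → ℂ) :
    ∫ y, f y ∂(p.bind k).toMeasure = ∫ x, ∫ y, f y ∂(k x).toMeasure ∂p.toMeasure := by
  have := Fintype.ofFinite α
  have := Fintype.ofFinite β
  simp only [PMF.integral_eq_sum, PMF.bind_apply, tsum_fintype, Finset.smul_sum]
  rw [Finset.sum_comm]
  refine Finset.sum_congr rfl fun y _ => ?_
  rw [ENNReal.toReal_sum fun x _ => ENNReal.mul_ne_top (p.apply_ne_top x) ((k x).apply_ne_top y),
    Finset.sum_smul]
  simp [mul_assoc]

lemma integral_map_pmf {α β : Type*} [Finite α] [Finite β] [MeasurableSpace α]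
    [MeasurableSpace β] [MeasurableSingletonClass α] [MeasurableSingletonClass β] (p : PMF α)
    (g : α → β) (f : β → ℂ) :
    ∫ y, f y ∂(p.map g).toMeasure = ∫ x, f (g x) ∂p.toMeasure := by
  rw [PMF.map, integral_bind]
  simp [PMF.toMeasure_pure]

lemma integral_switchLaw (q : unitInterval) (f : Bool → ℂ) :
    ∫ b, f b ∂(switchLaw q).toMeasure = q * f true + (1 - q) * f false := by
  have h0 := q.2.1
  have h1 := q.2.2
  simp [PMF.integral_eq_sum, switchLaw, ENNReal.toReal_ofReal, h0, h1]

open Classical in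
/-- A node `a` is the parent of a new node of type `s` with probability `(1 - q) / n` or `q / n`,
according to whether `a` has type `s` or not; in terms of the transform of the indicator. -/
lemma integral_parentLaw_indicator (q : unitInterval) (n : ℕ) [NeZero n] (s : NodeType)
    (a : Node n) (z : ℂ) :
    ∫ b, (1 + if a = b then z else 0) ∂(parentLaw q n s).toMeasure =
      1 + (if a.2 = s then 1 - (q : ℂ) else q) / n * z := by
  have hn : (n : ℂ) ≠ 0 := Nat.cast_ne_zero.2 (NeZero.ne n)
  obtain ⟨i, t⟩ := a
  rw [parentLaw, integral_bind]
  simp only [integral_map_pmf, integral_switchLaw]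
  simp only [PMF.integral_eq_sum, PMF.uniformOfFintype_apply, Prod.mk.injEq]
  cases s <;> cases t <;>
    simp [Finset.sum_add_distrib, Finset.sum_ite_eq] <;> field_simp <;> ring

open Classical in
/-- With `n` nodes of each type present, the two new nodes choose the same parent with
probability `2 q (1 - q) / n`; here in terms of the transform of the indicator. -/
lemma integral_parentLaw_coincide (q : unitInterval) (n : ℕ) [NeZero n] (z : ℂ) :
    ∫ a, ∫ b, (1 + if a = b then z else 0) ∂(parentLaw q n false).toMeasure
      ∂(parentLaw q n true).toMeasure = 1 + (2 * q * (1 - q) : ℝ) / n * z := by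
  have hn : (n : ℂ) ≠ 0 := Nat.cast_ne_zero.2 (NeZero.ne n)
  simp only [integral_parentLaw_indicator]
  rw [parentLaw, integral_bind]
  simp only [integral_map_pmf, integral_switchLaw]
  simp
  field_simp
  ring

open Classical in
/-- Coincidence at a step is independent of the past: its probability does not depend on `G`. -/
lemma integral_stepLaw (q : unitInterval) (n : ℕ) [NeZero n] (G : SimpleGraph (Node n)) (w : ℂ) :
    ∫ H, w ^ Z timeLabel H (n + 1) ∂(stepLaw q n G).toMeasure =
      w ^ Z timeLabel G n * (1 + (2 * q * (1 - q) : ℝ) / n * (w - 1)) := by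
  rw [stepLaw, integral_bind]
  simp only [integral_map_pmf, Z_grow (NeZero.one_le (n := n)), pow_add]
  simp only [integral_const_mul]
  rw [← integral_parentLaw_coincide]
  congr! with a b
  split_ifs <;> simp

/-- The generating function of `Z` under the law of the tree: that of a sum of independent
Bernoulli variables with parameters `2 q (1 - q) / m`. -/
lemma integral_pow_Z (q : unitInterval) (n : ℕ) (w : ℂ) :
    ∫ G, w ^ Z timeLabel G (n + 1) ∂(law q (n + 1)).toMeasure =
      ∏ m ∈ Finset.range n, (1 + (2 * q * (1 - q) : ℝ) / (m + 1 : ℕ) * (w - 1)) := by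
  induction n with
  | zero => simp [law, Z_one]
  | succ n ih =>
    rw [law, integral_bind]
    simp only [integral_stepLaw]
    rw [integral_mul_const, ih, Finset.prod_range_succ]

end Integrals

/-! ### Sums of independent Bernoulli variables with parameters `v / m` -/

section Poisson

open Complex

lemma norm_prod_sub_prod_le_sum {ι : Type*} (s : Finset ι) (a b : ι → ℂ)
    (ha : ∀ i ∈ s, ‖a i‖ ≤ 1) (hb : ∀ i ∈ s, ‖b i‖ ≤ 1) :
    ‖∏ i ∈ s, a i - ∏ i ∈ s, b i‖ ≤ ∑ i ∈ s, ‖a i - b i‖ := by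
  classical
  induction s using Finset.induction_on with
  | empty => simp
  | insert j s hj ih =>
    rw [Finset.prod_insert hj, Finset.prod_insert hj, Finset.sum_insert hj]
    have h1 := ih (fun i hi => ha i (Finset.mem_insert_of_mem hi))
      (fun i hi => hb i (Finset.mem_insert_of_mem hi))
    have h2 : ‖∏ i ∈ s, a i‖ ≤ 1 := by
      rw [norm_prod]
      exact Finset.prod_le_one (fun _ _ => norm_nonneg _)
        fun i hi => ha i (Finset.mem_insert_of_mem hi)
    have h3 := hb j (Finset.mem_insert_self j s)
    calc ‖a j * ∏ i ∈ s, a i - b j * ∏ i ∈ s, b i‖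
        = ‖(a j - b j) * ∏ i ∈ s, a i + b j * (∏ i ∈ s, a i - ∏ i ∈ s, b i)‖ := by ring_nf
      _ ≤ ‖a j - b j‖ * ‖∏ i ∈ s, a i‖ + ‖b j‖ * ‖∏ i ∈ s, a i - ∏ i ∈ s, b i‖ := by
        rw [← norm_mul, ← norm_mul]; exact norm_add_le _ _
      _ ≤ ‖a j - b j‖ * 1 + 1 * ‖∏ i ∈ s, a i - ∏ i ∈ s, b i‖ := by gcongr
      _ ≤ _ := by linarith

/-- The characteristic function of a Bernoulli variable is at most one in norm. -/
lemma norm_one_add_mul_exp_sub_one_le {p : ℝ} (h0 : 0 ≤ p) (h1 : p ≤ 1) (s : ℝ) :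
    ‖1 + (p : ℂ) * (exp (s * I) - 1)‖ ≤ 1 := by
  calc ‖1 + (p : ℂ) * (exp (s * I) - 1)‖ = ‖((1 - p : ℝ) : ℂ) + p * exp (s * I)‖ := by
        push_cast; ring_nf
    _ ≤ ‖((1 - p : ℝ) : ℂ)‖ + ‖(p : ℂ) * exp (s * I)‖ := norm_add_le _ _
    _ = 1 := by
      rw [norm_mul, norm_exp_ofReal_mul_I, norm_real, norm_real, Real.norm_of_nonneg h0,
        Real.norm_of_nonneg (sub_nonneg.2 h1)]
      ring

/-- The characteristic function of a Poisson variable is at most one in norm. -/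
lemma norm_exp_mul_exp_sub_one_le {p : ℝ} (h0 : 0 ≤ p) (s : ℝ) :
    ‖exp ((p : ℂ) * (exp (s * I) - 1))‖ ≤ 1 := by
  rw [norm_exp, Real.exp_le_one_iff, re_ofReal_mul, sub_re, exp_ofReal_mul_I_re, one_re]
  exact mul_nonpos_of_nonneg_of_nonpos h0 (sub_nonpos.2 (Real.cos_le_one s))

lemma norm_exp_mul_I_sub_one_le (s : ℝ) : ‖exp (s * I) - 1‖ ≤ |s| := by
  have := Real.norm_exp_I_mul_ofReal_sub_one_le (x := s)
  rwa [mul_comm] at this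

/-- Poisson approximation of a sum of independent Bernoulli variables, on the side of
characteristic functions. -/
lemma norm_prod_bernoulli_sub_exp_le {ι : Type*} (S : Finset ι) (p : ι → ℝ)
    (h0 : ∀ i, 0 ≤ p i) (h1 : ∀ i, p i ≤ 1) {s : ℝ} (hs : |s| ≤ 1) :
    ‖∏ i ∈ S, (1 + (p i : ℂ) * (exp (s * I) - 1)) -
      exp ((∑ i ∈ S, p i : ℝ) * (exp (s * I) - 1))‖ ≤ (∑ i ∈ S, p i ^ 2) * s ^ 2 := by
  rw [ofReal_sum, Finset.sum_mul, exp_sum, Finset.sum_mul]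
  refine (norm_prod_sub_prod_le_sum S _ _
    (fun i _ => norm_one_add_mul_exp_sub_one_le (h0 i) (h1 i) s)
    (fun i _ => norm_exp_mul_exp_sub_one_le (h0 i) s)).trans (Finset.sum_le_sum fun i _ => ?_)
  have h2 : ‖(p i : ℂ) * (exp (s * I) - 1)‖ ≤ p i * |s| := by
    rw [norm_mul, norm_real, Real.norm_of_nonneg (h0 i)]
    exact mul_le_mul_of_nonneg_left (norm_exp_mul_I_sub_one_le s) (h0 i)
  have h3 : p i * |s| ≤ 1 := mul_le_one₀ (h1 i) (abs_nonneg s) hs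
  rw [norm_sub_rev, ← sub_sub]
  calc _ ≤ ‖(p i : ℂ) * (exp (s * I) - 1)‖ ^ 2 := norm_exp_sub_one_sub_id_le (h2.trans h3)
    _ ≤ (p i * |s|) ^ 2 := by gcongr
    _ = _ := by rw [mul_pow, sq_abs]

lemma norm_exp_mul_I_taylor_two_le {s : ℝ} (hs : |s| ≤ 1) :
    ‖exp (s * I) - 1 - s * I + (s : ℂ) ^ 2 / 2‖ ≤ |s| ^ 3 := by
  have hn : ‖(s : ℂ) * I‖ = |s| := by simp
  have h := exp_bound (x := s * I) (by rwa [hn]) (n := 3) (by norm_num)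
  rw [hn] at h
  have e : exp (s * I) - ∑ m ∈ Finset.range 3, (s * I) ^ m / (m.factorial : ℂ) =
      exp (s * I) - 1 - s * I + (s : ℂ) ^ 2 / 2 := by
    simp only [Finset.sum_range_succ, Finset.sum_range_zero, mul_pow, I_sq]
    norm_num [Nat.factorial]
    ring
  rw [e] at h
  refine h.trans (mul_le_of_le_one_right (by positivity) ?_)
  norm_num [Nat.factorial]

/-- A sum of independent Bernoulli variables with parameters `v / m`, `m = 1, …, n`, centred by
`v log (n + 1)` and divided by the square root of this number, is asymptotically Gaussian: its
characteristic functions converge. -/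
lemma tendsto_prod_bernoulli {v : ℝ} (hv0 : 0 < v) (hv1 : v ≤ 1) (t : ℝ) :
    Tendsto (fun n : ℕ =>
      (∏ m ∈ Finset.range n, (1 + (v : ℂ) / (m + 1 : ℕ) *
        (exp ((t / √(v * Real.log (n + 1)) : ℝ) * I) - 1))) *
        exp (-((t / √(v * Real.log (n + 1)) * (v * Real.log (n + 1)) : ℝ) * I)))
      atTop (𝓝 (exp (-t ^ 2 / 2))) := by
  set L : ℕ → ℝ := fun n => Real.log (n + 1) with hL
  set s : ℕ → ℝ := fun n => t / √(v * L n) with hs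
  set p : ℕ → ℝ := fun m => v / (m + 1 : ℕ) with hp
  set z : ℕ → ℂ := fun n => exp (s n * I) - 1 with hz
  have hLtop : Tendsto L atTop atTop := Real.tendsto_log_atTop.comp
    (tendsto_atTop_add_const_right _ 1 tendsto_natCast_atTop_atTop)
  have hs0 : Tendsto s atTop (𝓝 0) := tendsto_const_nhds.div_atTop
    (Real.tendsto_sqrt_atTop.comp (hLtop.const_mul_atTop hv0))
  have hz0 : Tendsto z atTop (𝓝 0) := by
    have : Tendsto (fun n => exp (s n * I) - 1) atTop (𝓝 (exp ((0 : ℝ) * I) - 1)) :=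
      (((continuous_exp.comp (continuous_ofReal.mul continuous_const)).sub
        continuous_const).tendsto 0).comp hs0
    simpa using this
  have hp0 m : 0 ≤ p m := by positivity
  have hp1 m : p m ≤ 1 := div_le_one_of_le₀ (hv1.trans (by simp)) (by positivity)
  have hsum n : ∑ m ∈ Finset.range n, p m = v * harmonic n := by
    simp [hp, harmonic, Finset.mul_sum, div_eq_mul_inv]
  have hsummable : Summable fun m => p m ^ 2 := by
    have h := ((summable_nat_add_iff 1).2
      (Real.summable_one_div_nat_pow.2 one_lt_two)).mul_left (v ^ 2)
    refine h.congr fun m => ?_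
    simp [hp, mul_pow, div_eq_mul_inv]
  have hev1 : ∀ᶠ n in atTop, |s n| ≤ 1 := by
    have := hs0.abs
    rw [abs_zero] at this
    exact this.eventually_le_const one_pos
  -- Poisson approximation: the error is at most `s n ^ 2` times the convergent sum of the `p m ^ 2`
  have hdiff : Tendsto (fun n => (∏ m ∈ Finset.range n, (1 + (p m : ℂ) * z n)) -
      exp ((v * harmonic n : ℝ) * z n)) atTop (𝓝 0) := by
    refine squeeze_zero_norm' (a := fun n => (∑' m, p m ^ 2) * s n ^ 2) ?_ ?_
    · filter_upwards [hev1] with n hn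
      rw [← hsum]
      refine (norm_prod_bernoulli_sub_exp_le _ p hp0 hp1 hn).trans ?_
      gcongr
      exact hsummable.sum_le_tsum _ fun m _ => sq_nonneg _
    · simpa using (hs0.pow 2).const_mul (∑' m, p m ^ 2)
  -- Up to `t ^ 2 * |s n|`, the mean times `exp (i s) - 1 - i s` is `-(v * L n) * s n ^ 2 / 2`,
  -- and `(v * L n) * s n ^ 2 = t ^ 2`
  have htaylor : Tendsto (fun n => ((v * L n : ℝ) : ℂ) * (z n - s n * I + (s n : ℂ) ^ 2 / 2))
      atTop (𝓝 0) := by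
    refine squeeze_zero_norm' (a := fun n => t ^ 2 * |s n|) ?_ ?_
    · filter_upwards [hev1, hLtop.eventually_gt_atTop 0] with n hn hLn
      have hvL : 0 < v * L n := mul_pos hv0 hLn
      rw [norm_mul, norm_real, Real.norm_of_nonneg hvL.le]
      have e : v * L n * |s n| ^ 2 = t ^ 2 := by
        rw [sq_abs, hs, div_pow, Real.sq_sqrt hvL.le]
        field_simp
      calc _ ≤ v * L n * |s n| ^ 3 :=
            mul_le_mul_of_nonneg_left (norm_exp_mul_I_taylor_two_le hn) hvL.le
        _ = v * L n * |s n| ^ 2 * |s n| := by ring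
        _ = _ := by rw [e]
    · simpa using hs0.abs.const_mul (t ^ 2)
  -- The mean `v * harmonic n` differs from the centring by a bounded amount, and `z n` tends to `0`
  have hharm : Tendsto (fun n => ((v * (harmonic n - L n) : ℝ) : ℂ) * z n) atTop (𝓝 0) := by
    have h := (Real.tendsto_harmonic_sub_log_add_one.const_mul v).ofReal.mul hz0
    rwa [mul_zero] at h
  have hexp : Tendsto (fun n => exp ((v * harmonic n : ℝ) * z n - (s n * (v * L n) : ℝ) * I))
      atTop (𝓝 (exp (-t ^ 2 / 2))) := by
    refine (continuous_exp.tendsto _).comp ?_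
    have h := (hharm.add htaylor).add_const (-(t : ℂ) ^ 2 / 2)
    rw [add_zero, zero_add] at h
    refine h.congr' ?_
    filter_upwards [hLtop.eventually_gt_atTop 0] with n hLn
    have hvL : 0 < v * L n := mul_pos hv0 hLn
    have e : ((v * L n : ℝ) : ℂ) * (s n : ℂ) ^ 2 = (t : ℂ) ^ 2 := by
      rw [← ofReal_pow, ← ofReal_mul, hs, div_pow, Real.sq_sqrt hvL.le, ← ofReal_pow]
      congr 1
      field_simp
    rw [neg_div, ← e]
    push_cast
    ring
  have hres : Tendsto (fun n => ((∏ m ∈ Finset.range n, (1 + (p m : ℂ) * z n)) -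
      exp ((v * harmonic n : ℝ) * z n)) * exp (-((s n * (v * L n) : ℝ) * I))) atTop (𝓝 0) := by
    refine squeeze_zero_norm (fun n => ?_) (tendsto_zero_iff_norm_tendsto_zero.1 hdiff)
    rw [norm_mul, ← neg_mul, ← ofReal_neg, norm_exp_ofReal_mul_I, mul_one]
  have := hres.add hexp
  rw [zero_add] at this
  refine this.congr fun n => ?_
  have hpC m : ((p m : ℝ) : ℂ) = (v : ℂ) / (m + 1 : ℕ) := by simp [hp]
  simp only [hpC]
  change _ = (∏ m ∈ Finset.range n, (1 + (v : ℂ) / (m + 1 : ℕ) * z n)) *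
    exp (-((s n * (v * L n) : ℝ) * I))
  rw [sub_eq_add_neg (_ * z n), exp_add]
  ring

end Poisson

/-! ### Convergence in distribution -/

section Convergence

lemma _root_.MeasureTheory.TendstoInDistribution.congr_eventually {Ω Ω' E : Type*}
    {mΩ : MeasurableSpace Ω} {mΩ' : MeasurableSpace Ω'} {μ : Measure Ω} {μ' : Measure Ω'}
    [IsProbabilityMeasure μ] [IsProbabilityMeasure μ'] [TopologicalSpace E] [MeasurableSpace E]
    [OpensMeasurableSpace E] {X Y : ℕ → Ω → E} {U V : Ω' → E}
    (h : TendstoInDistribution X atTop U (fun _ => μ) μ') (hXY : ∀ᶠ n in atTop, X n =ᵐ[μ] Y n)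
    (hUV : U = V) (hY : ∀ n, AEMeasurable (Y n) μ) :
    TendstoInDistribution Y atTop V (fun _ => μ) μ' where
  forall_aemeasurable := hY
  aemeasurable_limit := hUV ▸ h.aemeasurable_limit
  tendsto := by
    subst hUV
    refine h.tendsto.congr' ?_
    filter_upwards [hXY] with n hn
    exact Subtype.ext (Measure.map_congr hn)

/-- Convergence in distribution to a constant is convergence in probability. -/
lemma _root_.MeasureTheory.TendstoInDistribution.tendstoInMeasure_const {Ω Ω' E : Type*}
    {mΩ : MeasurableSpace Ω} {mΩ' : MeasurableSpace Ω'} {μ : Measure Ω} {μ' : Measure Ω'}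
    [IsProbabilityMeasure μ] [IsProbabilityMeasure μ'] [PseudoMetricSpace E] [MeasurableSpace E]
    [BorelSpace E] {X : ℕ → Ω → E} {c : E}
    (h : TendstoInDistribution X atTop (fun _ => c) (fun _ => μ) μ') :
    TendstoInMeasure μ X atTop (fun _ => c) := by
  rw [tendstoInMeasure_iff_dist]
  intro ε hε
  have hF : IsClosed {x : E | ε ≤ dist x c} :=
    isClosed_le continuous_const (continuous_id.dist continuous_const)
  have hlim := ProbabilityMeasure.limsup_measure_closed_le_of_tendsto h.tendsto hF
  simp only [ProbabilityMeasure.coe_mk] at hlim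
  have h0 : (μ'.map fun _ => c) {x : E | ε ≤ dist x c} = 0 := by
    rw [Measure.map_apply measurable_const hF.measurableSet]
    simp [hε.not_ge]
  have hmap n : (μ.map (X n)) {x : E | ε ≤ dist x c} = μ {ω | ε ≤ dist (X n ω) c} :=
    Measure.map_apply_of_aemeasurable (h.forall_aemeasurable n) hF.measurableSet
  simp only [h0, hmap] at hlim
  exact tendsto_of_le_liminf_of_limsup_le bot_le hlim

end Convergence

/-! ### Asymptotic normality of the statistic -/

section CentralLimit

variable {Ω Ω' : Type*} [MeasurableSpace Ω] [MeasurableSpace Ω'] {P : Measure Ω}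
  {P' : Measure Ω'} {q : unitInterval} {T : (n : ℕ) → Ω → SimpleGraph (Node n)}

open Complex in
/-- The characteristic function of an affine image of the statistic is the generating function on
the unit circle, up to a phase. -/
lemma charFun_standardized_Z (hT : ∀ n, HasLaw (T n) (law q n).toMeasure P) (n : ℕ) (t c d : ℝ) :
    charFun (P.map fun ω => ((Z timeLabel (T (n + 1) ω) (n + 1) : ℝ) - c) / d) t =
      (∏ m ∈ Finset.range n, (1 + ((2 * q * (1 - q) : ℝ) : ℂ) / (m + 1 : ℕ) *
        (exp ((t / d : ℝ) * I) - 1))) * exp (-((t / d * c : ℝ) * I)) := by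
  have hm : AEMeasurable (fun ω => ((Z timeLabel (T (n + 1) ω) (n + 1) : ℝ) - c) / d) P :=
    (measurable_from_top (f := fun G => ((Z timeLabel G (n + 1) : ℝ) - c) / d)).comp_aemeasurable
      (hT (n + 1)).aemeasurable
  rw [charFun_apply_real, integral_map hm (by fun_prop), ← integral_pow_Z, ← integral_mul_const]
  rw [← (hT (n + 1)).integral_comp (measurable_from_top.aestronglyMeasurable)]
  refine integral_congr_ae (ae_of_all _ fun ω => ?_)
  simp only [Function.comp_apply]
  rw [← exp_nat_mul, ← exp_add]
  congr 1
  push_cast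
  ring

variable [IsProbabilityMeasure P] [IsProbabilityMeasure P']

/-- **Central limit theorem** for the number of coincident pairs. -/
theorem tendstoInDistribution_standardized_Z (hT : ∀ n, HasLaw (T n) (law q n).toMeasure P)
    (h0 : 0 < (q : ℝ)) (h1 : (q : ℝ) < 1) {Y : Ω' → ℝ} (hY : HasLaw Y (gaussianReal 0 1) P') :
    TendstoInDistribution (fun (n : ℕ) ω =>
      ((Z timeLabel (T n ω) n : ℝ) - 2 * q * (1 - q) * Real.log n) /
        √(2 * q * (1 - q) * Real.log n)) atTop Y (fun _ => P) P' where
  forall_aemeasurable n :=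
    (measurable_from_top (f := fun G => ((Z timeLabel G n : ℝ) - 2 * q * (1 - q) * Real.log n) /
      √(2 * q * (1 - q) * Real.log n))).comp_aemeasurable (hT n).aemeasurable
  aemeasurable_limit := hY.aemeasurable
  tendsto := by
    refine ProbabilityMeasure.tendsto_iff_tendsto_charFun.2 fun t => ?_
    -- the product formula is for `n + 1` time steps
    refine (tendsto_add_atTop_iff_nat 1).1 ?_
    have hv0 : 0 < 2 * (q : ℝ) * (1 - q) := by
      have := sub_pos.2 h1
      positivity
    have hv1 : 2 * (q : ℝ) * (1 - q) ≤ 1 := by nlinarith [sq_nonneg (2 * (q : ℝ) - 1)]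
    have h := tendsto_prod_bernoulli hv0 hv1 t
    simp only [ProbabilityMeasure.coe_mk, hY.map_eq, charFun_standardized_Z hT]
    simpa [charFun_gaussianReal, neg_div] using h

end CentralLimit

/-! ### The estimator -/

section Estimator

lemma continuous_phi : Continuous phi := by
  unfold phi
  fun_prop

lemma phi_mul_one_sub {q : ℝ} (hq : q ≤ 1 / 2) : phi (q * (1 - q)) = q := by
  have h : 1 - 4 * (q * (1 - q)) = (1 - 2 * q) ^ 2 := by ring
  rw [phi, h, max_eq_left (sq_nonneg _), Real.sqrt_sq (by linarith)]
  ring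

lemma hasDerivAt_phi {q : ℝ} (hq : q < 1 / 2) :
    HasDerivAt phi (1 / (1 - 2 * q)) (q * (1 - q)) := by
  have h : 1 - 4 * (q * (1 - q)) = (1 - 2 * q) ^ 2 := by ring
  have hpos : 0 < 1 - 2 * q := by linarith
  have h1 : HasDerivAt (fun x : ℝ => 1 - 4 * x) (-4) (q * (1 - q)) := by
    simpa using ((hasDerivAt_id (q * (1 - q))).const_mul 4).const_sub 1
  have h2 := ((h1.sqrt (by rw [h]; positivity)).const_sub 1).div_const 2
  rw [h, Real.sqrt_sq hpos.le] at h2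
  have h3 : HasDerivAt (fun x : ℝ => (1 - √(1 - 4 * x)) / 2) (1 / (1 - 2 * q)) (q * (1 - q)) := by
    refine h2.congr_deriv ?_
    have := hpos.ne'
    field_simp
    norm_num
  refine h3.congr_of_eventuallyEq ?_
  have hnhds : ∀ᶠ x in 𝓝 (q * (1 - q)), 0 < 1 - 4 * x :=
    h1.continuousAt.eventually_const_lt (by simp only [h]; positivity)
  filter_upwards [hnhds] with x hx
  rw [phi, max_eq_left hx.le]

lemma continuous_dslope_phi {q : ℝ} (hq : q < 1 / 2) :
    Continuous (dslope phi (q * (1 - q))) := by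
  rw [← continuousOn_univ, continuousOn_dslope univ_mem]
  exact ⟨continuous_phi.continuousOn, (hasDerivAt_phi hq).differentiableAt⟩

variable {Ω : Type*} [MeasurableSpace Ω] {P : Measure Ω}
  {q : unitInterval} {T : (n : ℕ) → Ω → SimpleGraph (Node n)}

lemma aemeasurable_qHat (hT : ∀ n, HasLaw (T n) (law q n).toMeasure P) (n : ℕ) :
    AEMeasurable (fun ω => qHat timeLabel (T n ω) n) P :=
  (measurable_from_top (f := fun G => qHat timeLabel G n)).comp_aemeasurable (hT n).aemeasurable

/-- For `q = 0` the generating function of `Z` is constant; at `0` it is the probability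
of `Z = 0`. -/
lemma hasLaw_qHat_zero [IsProbabilityMeasure P]
    (hT : ∀ n, HasLaw (T n) (law q n).toMeasure P) (hq : (q : ℝ) = 0) {n : ℕ} (hn : 1 ≤ n) :
    HasLaw (fun ω => qHat timeLabel (T n ω) n) (Measure.dirac (0 : ℝ)) P := by
  obtain ⟨n, rfl⟩ := Nat.exists_eq_add_of_le' hn
  refine hasLaw_dirac_of_ae_eq ?_
  have hgen := integral_pow_Z q n 0
  have hind : (fun G : SimpleGraph (Node (n + 1)) => (0 : ℂ) ^ Z timeLabel G (n + 1)) =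
      Set.indicator {G | Z timeLabel G (n + 1) = 0} fun _ => 1 := by
    ext G
    by_cases h : Z timeLabel G (n + 1) = 0 <;> simp [h]
  rw [hind, integral_indicator_const _ MeasurableSpace.measurableSet_top] at hgen
  simp only [hq, mul_zero, zero_mul, Complex.ofReal_zero, zero_div, add_zero, Finset.prod_const_one,
    Complex.real_smul, mul_one, Complex.ofReal_eq_one] at hgen
  have hae : ∀ᵐ G ∂(law q (n + 1)).toMeasure, Z timeLabel G (n + 1) = 0 := by
    rw [ae_iff_measure_eq MeasurableSpace.measurableSet_top.nullMeasurableSet, measure_univ]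
    rwa [measureReal_def, ENNReal.toReal_eq_one_iff] at hgen
  rw [← (hT (n + 1)).ae_iff measurable_from_top] at hae
  filter_upwards [hae] with ω hω
  simp [qHat, hω, phi]

variable (q) in
/-- The scale on which the argument of `phi` in the estimator fluctuates around `q (1 - q)`. -/
noncomputable def scale (n : ℕ) : ℝ := √(2 * q * (1 - q) * Real.log n) / (2 * Real.log n)

lemma tendsto_scale (q : unitInterval) : Tendsto (scale q) atTop (𝓝 0) := by
  have hlog : Tendsto (fun n : ℕ => Real.log n) atTop atTop :=
    Real.tendsto_log_atTop.comp tendsto_natCast_atTop_atTop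
  have h := (tendsto_const_nhds (x := √(2 * (q : ℝ) * (1 - q)) / 2)).div_atTop
    (Real.tendsto_sqrt_atTop.comp hlog)
  refine h.congr' ?_
  filter_upwards [hlog.eventually_gt_atTop 0] with n hn
  have hq := sub_nonneg.2 q.2.2
  have hq' := q.2.1
  have hs := Real.sq_sqrt hn.le
  have hs' := Real.sqrt_pos.2 hn
  rw [scale, Real.sqrt_mul (by positivity : 0 ≤ 2 * (q : ℝ) * (1 - q)), Function.comp_apply]
  nth_rewrite 3 [← hs]
  field_simp

/-- The estimator in terms of the standardized statistic. It fails at `n ≤ 1`, where `log n = 0`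
makes the quotients degenerate. -/
lemma qHat_eq {n : ℕ} (hn : 2 ≤ n) (h0 : 0 < (q : ℝ)) (h1 : (q : ℝ) < 1)
    (G : SimpleGraph (Node n)) :
    qHat timeLabel G n = phi (q * (1 - q) +
      (Z timeLabel G n - 2 * q * (1 - q) * Real.log n) / √(2 * q * (1 - q) * Real.log n) *
        scale q n) := by
  have hl : 0 < Real.log n := Real.log_pos (by exact_mod_cast hn)
  have h1' := sub_pos.2 h1
  have hs : 0 < √(2 * q * (1 - q) * Real.log n) := Real.sqrt_pos.2 (by positivity)
  rw [qHat, scale]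
  congr 1
  field_simp
  ring

variable [IsProbabilityMeasure P]

/-- Slutsky's theorem for functions of the standardized statistic and the deterministic scale. -/
lemma tendstoInDistribution_comp_standardized_Z {Ω' : Type*} [MeasurableSpace Ω']
    {P' : Measure Ω'} [IsProbabilityMeasure P']
    (hT : ∀ n, HasLaw (T n) (law q n).toMeasure P)
    (h0 : 0 < (q : ℝ)) (h1 : (q : ℝ) < 1) {Y : Ω' → ℝ} (hY : HasLaw Y (gaussianReal 0 1) P')
    {g : ℝ × ℝ → ℝ} (hg : Continuous g) :
    TendstoInDistribution (fun (n : ℕ) ω =>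
      g (((Z timeLabel (T n ω) n : ℝ) - 2 * q * (1 - q) * Real.log n) /
        √(2 * q * (1 - q) * Real.log n), scale q n)) atTop (fun ω => g (Y ω, 0))
      (fun _ => P) P' :=
  (tendstoInDistribution_standardized_Z hT h0 h1
    hY).continuous_comp_prodMk_of_tendstoInMeasure_const (Y := fun n _ => scale q n) hg
    (tendstoInMeasure_of_tendsto_ae (fun _ => aestronglyMeasurable_const)
      (ae_of_all _ fun _ => tendsto_scale q)) fun _ => aemeasurable_const

lemma tendstoInMeasure_qHat (hT : ∀ n, HasLaw (T n) (law q n).toMeasure P)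
    (hq : (q : ℝ) ≤ 1 / 2) :
    TendstoInMeasure P (fun n ω => qHat timeLabel (T n ω) n) atTop (fun _ => (q : ℝ)) := by
  rcases q.2.1.eq_or_lt with h0 | h0
  · refine TendstoInDistribution.tendstoInMeasure_const (μ' := P)
      ((tendstoInDistribution_const aemeasurable_const).congr_eventually ?_ rfl
        (aemeasurable_qHat hT))
    filter_upwards [eventually_ge_atTop 1] with n hn
    rw [← h0]
    exact (hasLaw_qHat_zero hT h0.symm hn).ae_eq_of_dirac.symm
  · refine TendstoInDistribution.tendstoInMeasure_const (μ' := gaussianReal 0 1)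
      ((tendstoInDistribution_comp_standardized_Z hT h0 (by linarith) HasLaw.id
        (g := fun p => phi (q * (1 - q) + p.1 * p.2))
        (continuous_phi.comp (by fun_prop))).congr_eventually ?_ ?_ (aemeasurable_qHat hT))
    · filter_upwards [eventually_ge_atTop 2] with n hn
      refine .of_eq (funext fun ω => ?_)
      rw [qHat_eq hn h0 (by linarith)]
    · simp [phi_mul_one_sub hq]

/-- The delta method: a difference of values of `phi` is the increment times `dslope phi`, which is
continuous and so takes the value of the derivative in the limit. -/
lemma tendstoInDistribution_qHat_of_lt (hT : ∀ n, HasLaw (T n) (law q n).toMeasure P)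
    (h0 : 0 < (q : ℝ)) (hq : (q : ℝ) < 1 / 2) :
    TendstoInDistribution
      (fun (n : ℕ) ω => √(2 * Real.log n / ((q : ℝ) * (1 - (q : ℝ)))) *
        (qHat timeLabel (T n ω) n - (q : ℝ)))
      atTop (fun x : ℝ => 1 / (1 - 2 * (q : ℝ)) * x) (fun _ => P) (gaussianReal 0 1) := by
  refine (tendstoInDistribution_comp_standardized_Z hT h0 (by linarith) HasLaw.id
    (g := fun p => p.1 * dslope phi (q * (1 - q)) (q * (1 - q) + p.1 * p.2))
    (continuous_fst.mul ((continuous_dslope_phi hq).comp (by fun_prop)))).congr_eventually ?_ ?_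
    fun n => ((aemeasurable_qHat hT n).sub_const _).const_mul _
  · filter_upwards [eventually_ge_atTop 2] with n hn
    refine .of_eq (funext fun ω => ?_)
    have hl : 0 < Real.log n := Real.log_pos (by exact_mod_cast hn)
    have h1 : 0 < 1 - (q : ℝ) := by linarith
    have hscale : √(2 * Real.log n / (q * (1 - q))) * scale q n = 1 := by
      rw [scale, ← mul_div_assoc, ← Real.sqrt_mul (by positivity),
        show 2 * Real.log n / (q * (1 - q)) * (2 * q * (1 - q) * Real.log n) =
          (2 * Real.log n) ^ 2 by field_simp, Real.sqrt_sq (by positivity)]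
      field_simp
    rw [qHat_eq hn h0 (by linarith)]
    set w := ((Z timeLabel (T n ω) n : ℝ) - 2 * q * (1 - q) * Real.log n) /
      √(2 * q * (1 - q) * Real.log n)
    have hd := sub_smul_dslope phi ((q : ℝ) * (1 - q)) (q * (1 - q) + w * scale q n)
    rw [add_sub_cancel_left, smul_eq_mul, phi_mul_one_sub hq.le] at hd
    rw [← hd]
    linear_combination (-w * dslope phi (q * (1 - q)) (q * (1 - q) + w * scale q n)) * hscale
  · ext x
    simp [dslope_same, (hasDerivAt_phi hq).deriv, mul_comm]

/-- At `q = 1 / 2` the argument of `phi` is centred at its singularity `1 / 4`, and for `n ≥ 2` the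
rescaled error is exactly `-√(max (-w) 0) / 2`, with `w` the standardized statistic. -/
lemma tendstoInDistribution_qHat_half (hT : ∀ n, HasLaw (T n) (law q n).toMeasure P)
    (hq : (q : ℝ) = 1 / 2) :
    TendstoInDistribution
      (fun (n : ℕ) ω => (Real.log n / 2) ^ (1 / 4 : ℝ) * (qHat timeLabel (T n ω) n - 1 / 2))
      atTop (fun x : ℝ => -(1 / 2) * √(max x 0)) (fun _ => P) (gaussianReal 0 1) := by
  -- the sign in front of `w` is absorbed by the symmetry of the Gaussian law
  have hneg : HasLaw (fun x : ℝ => -x) (gaussianReal 0 1) (gaussianReal 0 1) :=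
    ⟨by fun_prop, by simpa using gaussianReal_map_neg (μ := 0) (v := 1)⟩
  refine (tendstoInDistribution_comp_standardized_Z hT (by linarith) (by linarith) hneg
    (g := fun p => -(1 / 2) * √(max (-p.1) 0)) (by fun_prop)).congr_eventually ?_ (by simp)
    fun n => ((aemeasurable_qHat hT n).sub_const _).const_mul _
  filter_upwards [eventually_ge_atTop 2] with n hn
  refine .of_eq (funext fun ω => ?_)
  have hl : 0 < Real.log n / 2 := half_pos (Real.log_pos (by exact_mod_cast hn))
  rw [qHat_eq hn (by linarith) (by linarith), phi]
  set w := ((Z timeLabel (T n ω) n : ℝ) - 2 * q * (1 - q) * Real.log n) /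
    √(2 * q * (1 - q) * Real.log n)
  have hscale : scale q n = 1 / (4 * √(Real.log n / 2)) := by
    have e : 2 * (q : ℝ) * (1 - q) * Real.log n = Real.log n / 2 := by rw [hq]; ring
    have hs := Real.sqrt_pos.2 hl
    rw [scale, e, show 2 * Real.log n = 4 * √(Real.log n / 2) ^ 2 by
      rw [Real.sq_sqrt hl.le]; ring]
    field_simp
  have harg : 1 - 4 * (q * (1 - q) + w * scale q n) = -w / √(Real.log n / 2) := by
    rw [hscale, hq]
    field_simp
    ring
  have hroot : (Real.log n / 2) ^ (1 / 4 : ℝ) = √(√(Real.log n / 2)) := by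
    rw [Real.sqrt_eq_rpow, Real.sqrt_eq_rpow, ← Real.rpow_mul hl.le]
    norm_num
  have hmax : max (-w) 0 = √(Real.log n / 2) * max (-w / √(Real.log n / 2)) 0 := by
    rw [mul_max_of_nonneg _ _ (Real.sqrt_nonneg _), mul_zero,
      mul_div_cancel₀ _ (Real.sqrt_pos.2 hl).ne']
  rw [harg, hroot, hmax, Real.sqrt_mul (Real.sqrt_nonneg _)]
  ring

end Estimator

end BCMRT

/-- `T n` is a BCMRT with parameter `q ∈ [0, 1/2]` after `n` steps. Only the law of each `T n`
matters, so the trees at different times may be realised together in any way, in particular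
as the successive states of the growth process. -/
theorem mainTheorem5 {Ω : Type*} [MeasurableSpace Ω] (P : Measure Ω) [IsProbabilityMeasure P]
    (q : unitInterval) (hq : (q : ℝ) ≤ 1 / 2)
    (T : (n : ℕ) → Ω → SimpleGraph (BCMRT.Node n))
    (hT : ∀ n, HasLaw (T n) (BCMRT.law q n).toMeasure P) :
    TendstoInMeasure P (fun n ω => BCMRT.qHat BCMRT.timeLabel (T n ω) n) atTop
        (fun _ => (q : ℝ)) ∧
    ((q : ℝ) = 0 → ∀ n, 2 ≤ n →
      HasLaw (fun ω => BCMRT.qHat BCMRT.timeLabel (T n ω) n) (Measure.dirac (0 : ℝ)) P) ∧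
    (0 < (q : ℝ) → (q : ℝ) < 1 / 2 →
      TendstoInDistribution
        (fun (n : ℕ) ω => Real.sqrt (2 * Real.log n / ((q : ℝ) * (1 - (q : ℝ)))) *
          (BCMRT.qHat BCMRT.timeLabel (T n ω) n - (q : ℝ)))
        atTop (fun x : ℝ => 1 / (1 - 2 * (q : ℝ)) * x) (fun _ => P) (gaussianReal 0 1)) ∧
    ((q : ℝ) = 1 / 2 →
      TendstoInDistribution
        (fun (n : ℕ) ω => (Real.log n / 2) ^ (1 / 4 : ℝ) *
          (BCMRT.qHat BCMRT.timeLabel (T n ω) n - 1 / 2))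
        atTop (fun x : ℝ => -(1 / 2) * Real.sqrt (max x 0)) (fun _ => P)
        (gaussianReal 0 1)) := by
  refine ⟨BCMRT.tendstoInMeasure_qHat hT hq,
    fun h0 n hn => BCMRT.hasLaw_qHat_zero hT h0 (one_le_two.trans hn),
    fun h0 h1 => BCMRT.tendstoInDistribution_qHat_of_lt hT h0 h1,
    fun h => BCMRT.tendstoInDistribution_qHat_half hT h⟩
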